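/- Let $F=\langle a,b,c,d\mid a^2,b^2,c^2,d^2,bcd\rangle$, and write $0,1,2$ for the three non-trivial homomorphisms $\{1,b,c,d\}\to\{1,a\}$ with kernels $\langle b\rangle,\langle c\rangle,\langle d\rangle$ respectively. Let $\Omega=\{0,1,2\}^{\mathbb N}$, with shift map $\sigma(\omega_0\omega_1\omega_2\dots)=\omega_1\omega_2\dots$. For $\omega\in\Omega$ let $\tilde\phi_\omega\colon F\to F\wr\mathrm{Sym}(2)=(F\times F)\rtimes \mathrm{Sym}(2)$ be the homomorphism that maps $a$ to the transposition (with trivial labels) and each $x\in\{b,c,d\}$ to $(\omega_0(x),x)\in F\times F$. Define normal subgroups of $F$ by $N_{\omega,0}=1$ and $N_{\omega,i+1}=\tilde\phi_\omega^{-1}(N_{\sigma\omega,i}\times N_{\sigma\omega,i})$, and let the Grigorchuk group be $G_\omega=F/\bigcup_{i\ge0}N_{\omega,i}$. For a group $G$ with finite generating set $S$, let $v_{G,S}(R)$ be the number of elements of $G$ that are products of at most $R$ elements of $S\cup S^{-1}$. For functions $v,w$ write $v\precsim w$ if there is a constant $C>0$ with $v(R)\le w(CR)$ for all sufficiently large $R$,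 and $v\precnsim w$ if $v\precsim w$ but not $w\precsim v$. A finitely generated group $G$ has intermediate word growth if, for every finite generating set $S$, one has $R^d\precnsim v_{G,S}(R)\precnsim\exp(R)$ for all $d\in\mathbb N$. Theorem (Grigorchuk). If $\omega\in\Omega$ contains infinitely many of each of the symbols $0,1,2$, then $G_\omega$ has intermediate word growth. -/

import Mathlib

/-! ## Word growth of finitely generated groups -/

namespace WordGrowth

/-- The ball of radius `R` around `1` in the word metric of `G` with respect to `S`: the elements
that are products of at most `R` factors, each in `S` or inverse to an element of `S`. -/
def ball {G : Type*} [Group G] (S : Finset G) (R : ℝ) : Set G :=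
  {g | ∃ l : List G, (∀ s ∈ l, s ∈ S ∨ s⁻¹ ∈ S) ∧ (l.length : ℝ) ≤ R ∧ l.prod = g}

/-- The growth function `v_{G,S}(R)`, the number of elements of norm at most `R`
(balls are finite, since `S` is). -/
noncomputable def growth {G : Type*} [Group G] (S : Finset G) (R : ℝ) : ℝ :=
  ((ball S R).ncard : ℝ)

/-- Domination `v ≾ w`: there is a constant `C` with `v(R) ≤ w(CR)` for all large `R`. -/
def Dominated (v w : ℝ → ℝ) : Prop :=
  ∃ C : ℝ, 0 < C ∧ ∀ᶠ R in Filter.atTop, v R ≤ w (C * R)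

/-- Strict domination: `v ≾ w`, but not `w ≾ v`. -/
def StrictlyDominated (v w : ℝ → ℝ) : Prop :=
  Dominated v w ∧ ¬ Dominated w v

/-- A function of intermediate type: strictly above every polynomial, strictly below `exp`. -/
def IsIntermediate (v : ℝ → ℝ) : Prop :=
  (∀ d : ℕ, StrictlyDominated (fun R => R ^ d) v) ∧ StrictlyDominated v Real.exp

/-- `G` is finitely generated, and its growth function, with respect to whichever finite
generating set, is of intermediate type. -/
def HasIntermediateGrowth (G : Type*) [Group G] : Prop :=
  Group.FG G ∧ ∀ S : Finset G, Subgroup.closure (S : Set G) = ⊤ → IsIntermediate (growth S)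

end WordGrowth

/-! ## The Grigorchuk groups -/

namespace Grigorchuk

/-- The four generating letters. -/
inductive Letter : Type
  | a | b | c | d

/-- The relators `a²`, `b²`, `c²`, `d²`, `bcd`. -/
def relators : Set (FreeGroup Letter) :=
  {FreeGroup.of Letter.a ^ 2, FreeGroup.of Letter.b ^ 2, FreeGroup.of Letter.c ^ 2,
    FreeGroup.of Letter.d ^ 2,
    FreeGroup.of Letter.b * FreeGroup.of Letter.c * FreeGroup.of Letter.d}

/-- `F = ⟨a, b, c, d | a², b², c², d², bcd⟩`. -/
abbrev F : Type := PresentedGroup relators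

/-- The generator of `F` named by a letter. -/
def gen (x : Letter) : F := PresentedGroup.of x

/-- The permutational wreath product `H ≀ Sym(2) = (H × H) ⋊ Sym(2)`, with `π` acting on
functions `{0, 1} → H` by `f ↦ f ∘ π⁻¹`. -/
abbrev Wreath (H : Type*) [Group H] : Type _ :=
  (Fin 2 → H) ⋊[(mulAutArrow : Equiv.Perm (Fin 2) →* MulAut (Fin 2 → H))] Equiv.Perm (Fin 2)

/-- The values of the homomorphism `k : {1, b, c, d} → {1, a}` on letters. The kernels of
`0`, `1`, `2` are generated by `b`, `c`, `d` respectively. (The value at the letter `a` is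
not used.) -/
def eps : Fin 3 → Letter → F
  | 0, Letter.b => 1
  | 1, Letter.c => 1
  | 2, Letter.d => 1
  | _, _ => gen Letter.a

/-- The wreath recursion on generators, for the leading symbol `k`: the letter `a` becomes the
transposition with trivial labels, and `x ∈ {b, c, d}` becomes the trivial permutation with
label `k(x)` at `0` and `x` at `1`. -/
def recLetter (k : Fin 3) : Letter → Wreath F
  | Letter.a => ⟨1, Equiv.swap 0 1⟩
  | x => ⟨![eps k x, gen x], 1⟩

theorem gen_relations :
    gen Letter.a * gen Letter.a = 1 ∧ gen Letter.b * gen Letter.b = 1 ∧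
    gen Letter.c * gen Letter.c = 1 ∧ gen Letter.d * gen Letter.d = 1 ∧
    gen Letter.b * gen Letter.c * gen Letter.d = 1 := by
  have key : ∀ r ∈ relators, PresentedGroup.mk relators r = 1 := fun r hr =>
    PresentedGroup.one_of_mem hr
  simp only [relators, Set.mem_insert_iff, Set.mem_singleton_iff, forall_eq_or_imp, forall_eq,
    pow_two] at key
  exact key

theorem recLetter_relators (k : Fin 3) :
    ∀ r ∈ relators, FreeGroup.lift (recLetter k) r = 1 := by
  obtain ⟨ha, hb, hc, hd, hbcd⟩ := gen_relations
  simp only [relators, Set.mem_insert_iff, Set.mem_singleton_iff, forall_eq_or_imp, forall_eq,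
    pow_two, map_mul, FreeGroup.lift_apply_of]
  fin_cases k <;>
  · refine ⟨?_, ?_, ?_, ?_, ?_⟩ <;>
    · refine SemidirectProduct.ext ?_ ?_
      · funext i
        fin_cases i <;> simp [recLetter, eps, ha, hb, hc, hd, hbcd]
      · simp [recLetter]

/-- The homomorphism `F → F ≀ Sym(2)` attached to the symbol `k`. -/
def recHom (k : Fin 3) : F →* Wreath F :=
  PresentedGroup.toGroup (recLetter_relators k)

/-- The shift map on sequences. -/
def shift (ω : ℕ → Fin 3) : ℕ → Fin 3 := fun n => ω (n + 1)

/-- The subgroup `K × K` of the base group of `H ≀ Sym(2)`. -/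
def baseSquare {H : Type*} [Group H] (K : Subgroup H) : Subgroup (Wreath H) :=
  (Subgroup.pi Set.univ (fun _ : Fin 2 => K)).map SemidirectProduct.inl

theorem mem_baseSquare {H : Type*} [Group H] (K : Subgroup H) (x : Wreath H) :
    x ∈ baseSquare K ↔ (∀ i, x.left i ∈ K) ∧ x.right = 1 := by
  constructor
  · rintro ⟨f, hf, rfl⟩
    exact ⟨fun i => by simpa using hf i (Set.mem_univ i), by simp⟩
  · rintro ⟨h1, h2⟩
    exact ⟨x.left, fun i _ => h1 i, SemidirectProduct.ext (by simp) (by simp [h2])⟩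

/-- The subgroups `N_{ω,i}` of `F`: `N_{ω,0} = 1`, and `N_{ω,i+1}` is the preimage of
`N_{σω,i} × N_{σω,i}` under the wreath recursion of `ω`. -/
def N : ℕ → (ℕ → Fin 3) → Subgroup F
  | 0, _ => ⊥
  | i + 1, ω => (baseSquare (N i (shift ω))).comap (recHom (ω 0))

theorem baseSquare_normal {H : Type*} [Group H] (K : Subgroup H) (hK : K.Normal) :
    (baseSquare K).Normal := by
  constructor
  intro n hn g
  rw [mem_baseSquare] at hn ⊢
  obtain ⟨h1, h2⟩ := hn
  refine ⟨fun i => ?_, by simp [h2]⟩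
  have e : (g * n * g⁻¹).left i = g.left i * n.left (g.right⁻¹ i) * (g.left i)⁻¹ := by
    simp [h2]
    rfl
  rw [e]
  exact hK.conj_mem _ (h1 _) (g.left i)

theorem N_normal (i : ℕ) : ∀ ω, (N i ω).Normal := by
  induction i with
  | zero => intro ω; exact inferInstanceAs (⊥ : Subgroup F).Normal
  | succ i ih =>
    intro ω
    exact (baseSquare_normal _ (ih (shift ω))).comap (recHom (ω 0))

theorem N_le_succ (i : ℕ) : ∀ ω, N i ω ≤ N (i + 1) ω := by
  induction i with
  | zero => intro ω; exact bot_le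
  | succ i ih =>
    intro ω
    exact Subgroup.comap_mono (Subgroup.map_mono
      (fun f hf j hj => ih (shift ω) (hf j hj)))

/-- The normal subgroup `⋃ i, N_{ω,i}` of `F`. -/
def kernel (ω : ℕ → Fin 3) : Subgroup F := ⨆ i, N i ω

theorem mem_kernel (ω : ℕ → Fin 3) (g : F) : g ∈ kernel ω ↔ ∃ i, g ∈ N i ω :=
  Subgroup.mem_iSup_of_directed (monotone_nat_of_le_succ (fun i => N_le_succ i ω)).directed_le

instance kernel_normal (ω : ℕ → Fin 3) : (kernel ω).Normal := by
  constructor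
  intro n hn g
  rw [mem_kernel] at hn ⊢
  obtain ⟨i, hi⟩ := hn
  exact ⟨i, (N_normal i ω).conj_mem n hi g⟩

/-- The Grigorchuk group `G_ω = F / ⋃ i, N_{ω,i}`. -/
abbrev GrigorchukGroup (ω : ℕ → Fin 3) : Type := F ⧸ kernel ω

end Grigorchuk

/-! ### Self-similarity of the kernel and sections of words. -/

namespace Grigorchuk

/-! Both bounds compare the growth of `G_ω` with that of `G_{σω}`. The wreath recursion embeds `G_ω`
in `G_{σω} ≀ Sym(2)`, so an element is determined by a permutation and two sections
(`eval_eq_eval_iff`).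

Upper bound: weigh `a` by 1, the letters of a set `T` by 2 and the other letters by 3. Words of
least weight alternate between `a` and `b, c, d`. Consequently the two sections together weigh at
most one more than the word, even if the letter killed by the leading symbol weighs 2 before the
recursion and 3 after it (`weight_sections_le`). So convergence of `∑ exp (-s * norm)` passes from
`σω` to `ω` at the same `s` (`Converges.of_shift`). Along a block containing all three symbols,
every weight 3 has become a weight 2; on alternating words this changes the norm by a factor of
about 3/4, so `s` may be replaced by `3/4 * s`. Iterating gives convergence for all `s > 0`, which
is subexponential growth.

Lower bound: if `u ≠ a` is not killed, replacing `a` by `aua` lifts any word to one with that word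
as section at 1, while the section at 0 lies in the finite dihedral group `⟨a, u⟩`. Lifting into
both coordinates gives `v_{σω}(n)^2 ≤ M * v_ω(6n + 2)` (`exists_sq_ncard_letterBall_le`). Starting
from growth at least of order `√n`, repeated squaring beats every polynomial. -/

theorem inv_mul_mem_baseSquare {H : Type*} [Group H] (K : Subgroup H) (x y : Wreath H) :
    x⁻¹ * y ∈ baseSquare K ↔ x.right = y.right ∧ ∀ j, (x.left j)⁻¹ * y.left j ∈ K := by
  have e : ∀ i, (x⁻¹ * y).left i = (x.left (x.right i))⁻¹ * y.left (x.right i) := by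
    intro i
    simp
    rfl
  rw [mem_baseSquare, and_comm]
  refine and_congr ?_ ?_
  · rw [SemidirectProduct.mul_right, SemidirectProduct.inv_right, inv_mul_eq_one]
  · simp only [e]
    exact (x.right.forall_congr_left
      (p := fun i => (x.left (x.right i))⁻¹ * y.left (x.right i) ∈ K)).trans
      (by simp)

/-- The `N_{ω,i}` increase with `i`, so if the two coordinates die at different levels, both are
dead at the larger one. -/
theorem mem_kernel_iff (ω : ℕ → Fin 3) (g : F) :
    g ∈ kernel ω ↔ recHom (ω 0) g ∈ baseSquare (kernel (shift ω)) := by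
  rw [mem_kernel, mem_baseSquare]
  constructor
  · rintro ⟨i, hi⟩
    have hi' : recHom (ω 0) g ∈ baseSquare (N i (shift ω)) := N_le_succ i ω hi
    rw [mem_baseSquare] at hi'
    exact ⟨fun j => (mem_kernel _ _).2 ⟨i, hi'.1 j⟩, hi'.2⟩
  · rintro ⟨h1, h2⟩
    obtain ⟨i, hi⟩ := (mem_kernel _ _).1 (h1 0)
    obtain ⟨j, hj⟩ := (mem_kernel _ _).1 (h1 1)
    have mono := monotone_nat_of_le_succ (fun i => N_le_succ i (shift ω))
    refine ⟨max i j + 1, (mem_baseSquare _ _).2 ⟨fun t => ?_, h2⟩⟩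
    fin_cases t
    · exact mono (le_max_left i j) hi
    · exact mono (le_max_right i j) hj

/-- Two elements of `F` agree in `G_ω` exactly when their wreath decompositions agree over
`G_{σω}`. -/
theorem mk_eq_mk_iff (ω : ℕ → Fin 3) (g h : F) :
    (g : GrigorchukGroup ω) = h ↔ (recHom (ω 0) g).right = (recHom (ω 0) h).right ∧
      ∀ j, ((recHom (ω 0) g).left j : GrigorchukGroup (shift ω)) = (recHom (ω 0) h).left j := by
  rw [QuotientGroup.eq, mem_kernel_iff, map_mul, map_inv, inv_mul_mem_baseSquare]
  simp only [QuotientGroup.eq]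

/-- The element of `F` spelled by a word. -/
def word (l : List Letter) : F := (l.map gen).prod

/-- The element of `G_ω` spelled by a word. -/
def eval (ω : ℕ → Fin 3) (l : List Letter) : GrigorchukGroup ω := (word l : F)

@[simp] theorem word_nil : word [] = 1 := rfl

@[simp] theorem word_cons (s : Letter) (l : List Letter) : word (s :: l) = gen s * word l := by
  simp [word]

@[simp] theorem word_append (l m : List Letter) : word (l ++ m) = word l * word m := by
  simp [word]

theorem eval_append (ω : ℕ → Fin 3) (l m : List Letter) :
    eval ω (l ++ m) = eval ω l * eval ω m := by
  simp [eval]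

theorem eval_cons (ω : ℕ → Fin 3) (s : Letter) (m : List Letter) :
    eval ω (s :: m) = eval ω [s] * eval ω m := by
  simp [eval]

theorem gen_mul_self (s : Letter) : gen s * gen s = 1 := by
  obtain ⟨ha, hb, hc, hd, -⟩ := gen_relations
  cases s <;> assumption

theorem gen_inv (s : Letter) : (gen s)⁻¹ = gen s :=
  inv_eq_of_mul_eq_one_left (gen_mul_self s)

theorem word_reverse (l : List Letter) : word l.reverse = (word l)⁻¹ := by
  induction l with
  | nil => simp
  | cons s l ih => simp [ih, gen_inv]

theorem word_surjective : Function.Surjective word := by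
  intro g
  have hg : g ∈ Subgroup.closure (Set.range (PresentedGroup.of (rels := relators))) := by
    rw [PresentedGroup.closure_range_of]; trivial
  induction hg using Subgroup.closure_induction with
  | mem x hx =>
    obtain ⟨s, rfl⟩ := hx
    exact ⟨[s], by simp [gen]⟩
  | one => exact ⟨[], rfl⟩
  | mul x y _ _ hx hy =>
    obtain ⟨l, rfl⟩ := hx
    obtain ⟨m, rfl⟩ := hy
    exact ⟨l ++ m, by simp⟩
  | inv x _ hx =>
    obtain ⟨l, rfl⟩ := hx
    exact ⟨l.reverse, word_reverse l⟩

theorem eval_surjective (ω : ℕ → Fin 3) : Function.Surjective (eval ω) :=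
  (QuotientGroup.mk_surjective).comp word_surjective

/-- The letter killed by the symbol `k`. -/
def killed : Fin 3 → Letter
  | 0 => Letter.b
  | 1 => Letter.c
  | 2 => Letter.d

instance : DecidableEq Letter := fun x y => by
  cases x <;> cases y <;> first | exact isTrue rfl | exact isFalse (by nofun)

instance : Fintype Letter := ⟨{Letter.a, Letter.b, Letter.c, Letter.d}, by
  intro x; cases x <;> simp⟩

theorem recHom_a (k : Fin 3) (g : F) :
    (recHom k (gen Letter.a * g)).right = Equiv.swap 0 1 * (recHom k g).right ∧
    (recHom k (gen Letter.a * g)).left 0 = (recHom k g).left 1 ∧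
    (recHom k (gen Letter.a * g)).left 1 = (recHom k g).left 0 := by
  have e : recHom k (gen Letter.a) = ⟨1, Equiv.swap 0 1⟩ := by
    simp [recHom, gen, recLetter]
  rw [map_mul, e]
  refine ⟨by simp, ?_, ?_⟩
  · change 1 * (recHom k g).left ((Equiv.swap (0 : Fin 2) 1)⁻¹ 0) = _
    simp
  · change 1 * (recHom k g).left ((Equiv.swap (0 : Fin 2) 1)⁻¹ 1) = _
    simp

theorem recHom_of_ne_a (k : Fin 3) (s : Letter) (hs : s ≠ Letter.a) (g : F) :
    (recHom k (gen s * g)).right = (recHom k g).right ∧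
    (recHom k (gen s * g)).left 0 =
      (if s = killed k then 1 else gen Letter.a) * (recHom k g).left 0 ∧
    (recHom k (gen s * g)).left 1 = gen s * (recHom k g).left 1 := by
  have e : recHom k (gen s) = ⟨![eps k s, gen s], 1⟩ := by
    cases s <;> simp_all [recHom, gen, recLetter]
  have e' : eps k s = if s = killed k then 1 else gen Letter.a := by
    fin_cases k <;> cases s <;> simp_all [eps, killed]
  rw [map_mul, e, ← e']
  refine ⟨by simp, by simp, by simp⟩

/-- The two sections of a word, at `0` and at `1`. -/
def sections (k : Fin 3) : List Letter → List Letter × List Letter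
  | [] => ([], [])
  | s :: l =>
    if s = Letter.a then ((sections k l).2, (sections k l).1)
    else (if s = killed k then (sections k l).1 else Letter.a :: (sections k l).1,
      s :: (sections k l).2)

theorem word_sections (k : Fin 3) (l : List Letter) :
    (recHom k (word l)).left 0 = word (sections k l).1 ∧
    (recHom k (word l)).left 1 = word (sections k l).2 := by
  induction l with
  | nil => simp [sections]
  | cons s l ih =>
    rw [word_cons]
    by_cases hs : s = Letter.a
    · subst hs
      obtain ⟨-, h0, h1⟩ := recHom_a k (word l)
      rw [h0, h1, ih.1, ih.2]
      simp [sections]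
    · obtain ⟨-, h0, h1⟩ := recHom_of_ne_a k s hs (word l)
      rw [h0, h1, ih.1, ih.2]
      by_cases hk : s = killed k <;> simp [sections, hs, hk]
      subst hk
      simp [hs]

theorem eval_eq_eval_iff (ω : ℕ → Fin 3) (l m : List Letter) :
    eval ω l = eval ω m ↔ (recHom (ω 0) (word l)).right = (recHom (ω 0) (word m)).right ∧
      eval (shift ω) (sections (ω 0) l).1 = eval (shift ω) (sections (ω 0) m).1 ∧
      eval (shift ω) (sections (ω 0) l).2 = eval (shift ω) (sections (ω 0) m).2 := by
  rw [eval, eval, mk_eq_mk_iff, Fin.forall_fin_two, (word_sections _ l).1, (word_sections _ l).2,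
    (word_sections _ m).1, (word_sections _ m).2]
  rfl

theorem exists_word_gen_mul_gen {s t : Letter} (hs : s ≠ Letter.a) (ht : t ≠ Letter.a) :
    s = t ∨ ∃ u, u ≠ Letter.a ∧ gen s * gen t = gen u := by
  obtain ⟨-, hb, hc, hd, h⟩ := gen_relations
  have bc : gen Letter.b * gen Letter.c = gen Letter.d := by
    rw [eq_comm, ← gen_inv]; exact inv_eq_of_mul_eq_one_left h
  have cd : gen Letter.c * gen Letter.d = gen Letter.b := by
    rw [eq_comm, ← gen_inv]
    exact inv_eq_of_mul_eq_one_right ((mul_assoc _ _ _).symm.trans h)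
  have db : gen Letter.d * gen Letter.b = gen Letter.c := by
    rw [eq_comm, ← gen_inv]
    refine inv_eq_of_mul_eq_one_left ?_
    rw [mul_assoc, bc, hd]
  have inv : ∀ {x y z : Letter}, gen x * gen y = gen z → gen y * gen x = gen z := by
    intro x y z e
    rw [← gen_inv z, ← e, mul_inv_rev, gen_inv, gen_inv]
  cases s <;> cases t <;> first
    | exact absurd rfl hs
    | exact absurd rfl ht
    | exact Or.inl rfl
    | exact Or.inr ⟨Letter.b, by nofun, by first | exact cd | exact inv cd⟩
    | exact Or.inr ⟨Letter.c, by nofun, by first | exact db | exact inv db⟩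
    | exact Or.inr ⟨Letter.d, by nofun, by first | exact bc | exact inv bc⟩

end Grigorchuk

/-! ### Upper bound: weighted norms and growth series. -/

namespace Grigorchuk

/-- The weight of a letter: `a` weighs `1`, letters in `T` weigh `2`, the others weigh `3`. -/
def letterWeight (T : Finset Letter) (s : Letter) : ℕ :=
  if s = Letter.a then 1 else if s ∈ T then 2 else 3

/-- The weight of a word. -/
def weight (T : Finset Letter) (l : List Letter) : ℕ := (l.map (letterWeight T)).sum

theorem weight_cons (T : Finset Letter) (s : Letter) (l : List Letter) :
    weight T (s :: l) = letterWeight T s + weight T l := by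
  simp [weight]

theorem weight_append (T : Finset Letter) (l m : List Letter) :
    weight T (l ++ m) = weight T l + weight T m := by
  simp [weight]

theorem length_le_weight (T : Finset Letter) (l : List Letter) : l.length ≤ weight T l := by
  induction l with
  | nil => simp
  | cons s l ih =>
    rw [weight_cons, List.length_cons]
    have : 1 ≤ letterWeight T s := by unfold letterWeight; split_ifs <;> omega
    omega

theorem weight_le_length (T : Finset Letter) (l : List Letter) : weight T l ≤ 3 * l.length := by
  induction l with
  | nil => simp [weight]
  | cons s l ih =>
    rw [weight_cons, List.length_cons]
    have : letterWeight T s ≤ 3 := by unfold letterWeight; split_ifs <;> omega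
    omega

theorem exists_minimal_word (ω : ℕ → Fin 3) (T : Finset Letter) (g : GrigorchukGroup ω) :
    ∃ l, eval ω l = g ∧ ∀ m, eval ω m = g → weight T l ≤ weight T m := by
  obtain ⟨l, hl⟩ := eval_surjective ω g
  exact WellFounded.has_min (measure (weight T)).wf {l | eval ω l = g} ⟨l, hl⟩ |>.imp
    fun l h => ⟨h.1, fun m hm => not_lt.1 (h.2 m hm)⟩

/-- A word of minimal weight spelling `g`. -/
noncomputable def minWord (ω : ℕ → Fin 3) (T : Finset Letter) (g : GrigorchukGroup ω) :
    List Letter :=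
  (exists_minimal_word ω T g).choose

theorem eval_minWord (ω : ℕ → Fin 3) (T : Finset Letter) (g : GrigorchukGroup ω) :
    eval ω (minWord ω T g) = g :=
  (exists_minimal_word ω T g).choose_spec.1

/-- The least weight of a word spelling `g`. -/
noncomputable def norm (ω : ℕ → Fin 3) (T : Finset Letter) (g : GrigorchukGroup ω) : ℕ :=
  weight T (minWord ω T g)

theorem norm_eval_le (ω : ℕ → Fin 3) (T : Finset Letter) (l : List Letter) :
    norm ω T (eval ω l) ≤ weight T l :=
  (exists_minimal_word ω T (eval ω l)).choose_spec.2 l rfl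

/-- Equal letters cancel. Distinct letters among `b, c, d` multiply to the third, of weight at most
3, whereas the pair weighs at least 4. This forces minimal words to alternate. -/
theorem exists_lighter (T : Finset Letter) {s t : Letter} (h : s = Letter.a ↔ t = Letter.a) :
    ∃ l, word l = gen s * gen t ∧ weight T l < letterWeight T s + letterWeight T t := by
  by_cases hs : s = Letter.a
  · obtain rfl := hs
    obtain rfl := h.1 rfl
    exact ⟨[], by simp [gen_mul_self], by simp [weight, letterWeight]⟩
  · have ht : ¬t = Letter.a := fun ht => hs (h.2 ht)
    have ws : 2 ≤ letterWeight T s := by unfold letterWeight; split_ifs <;> omega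
    have wt : 2 ≤ letterWeight T t := by unfold letterWeight; split_ifs <;> omega
    rcases exists_word_gen_mul_gen hs ht with rfl | ⟨u, hu, e⟩
    · exact ⟨[], by simp [gen_mul_self], by
        have : weight T [] = 0 := rfl
        omega⟩
    · refine ⟨[u], by simp [e], lt_of_le_of_lt (weight_le_length T [u]) ?_⟩
      simp
      omega

theorem isChain_minWord (ω : ℕ → Fin 3) (T : Finset Letter) (g : GrigorchukGroup ω) :
    ((minWord ω T g).map fun s => decide (s = Letter.a)).IsChain (· ≠ ·) := by
  rw [List.isChain_map, List.isChain_iff_forall_rel_of_append_cons_cons]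
  intro s t l₁ l₂ hl hst
  obtain ⟨m, hm, hw⟩ := exists_lighter T (decide_eq_decide.1 hst)
  have h := (exists_minimal_word ω T g).choose_spec.2 (l₁ ++ (m ++ l₂)) (by
    rw [← eval_minWord ω T g, hl]
    simp [eval, hm, mul_assoc])
  change weight T (minWord ω T g) ≤ _ at h
  rw [hl] at h
  simp only [weight_append, weight_cons] at h
  omega

/-- The number of letters `a` of a word. -/
def countA (l : List Letter) : ℕ := l.countP fun s => decide (s = Letter.a)

/-- The number of letters other than `a` of a word. -/
def countX (l : List Letter) : ℕ := l.countP fun s => !decide (s = Letter.a)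

theorem countA_minWord (ω : ℕ → Fin 3) (T : Finset Letter) (g : GrigorchukGroup ω) :
    countA (minWord ω T g) ≤ countX (minWord ω T g) + 1 ∧
    countX (minWord ω T g) ≤ countA (minWord ω T g) + 1 := by
  have h := isChain_minWord ω T g
  have hA : ∀ l, countA l = (l.map fun s => decide (s = Letter.a)).count true := by
    intro l; simp [countA, List.count, List.countP_map, Function.comp_def]
  have hX : ∀ l, countX l = (l.map fun s => decide (s = Letter.a)).count false := by
    intro l; simp [countX, List.count, List.countP_map, Function.comp_def]
  rw [hA, hX]
  exact ⟨h.count_true_le_count_false_add_one, h.count_false_le_count_true_add_one⟩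

theorem weight_univ_add (l : List Letter) :
    weight Finset.univ l = countA l + 2 * countX l ∧ weight ∅ l = countA l + 3 * countX l := by
  induction l with
  | nil => simp [weight, countA, countX]
  | cons s l ih =>
    obtain ⟨h1, h2⟩ := ih
    rw [weight_cons, weight_cons, h1, h2]
    by_cases hs : s = Letter.a <;> simp [countA, countX, letterWeight, hs] <;> omega

/-- With `A` letters `a` and `X` others, the weights are `A + 2X` and `A + 3X`; alternation makes `A
≤ X + 1`, whence the ratio 3/4 up to a constant. This is the source of the contraction. -/
theorem norm_univ_le (ω : ℕ → Fin 3) (g : GrigorchukGroup ω) :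
    4 * norm ω Finset.univ g ≤ 3 * norm ω ∅ g + 4 := by
  have h1 := norm_eval_le ω Finset.univ (minWord ω ∅ g)
  rw [eval_minWord] at h1
  have h2 := weight_univ_add (minWord ω ∅ g)
  have h3 := countA_minWord ω ∅ g
  have h4 : norm ω ∅ g = _ := h2.2
  omega

/-- Count letter by letter: `a` vanishes and saves 1. A surviving letter yields itself and an extra
`a`, costing at most 1. The killed letter yields only itself, so it can afford to go from weight 2
to weight 3. -/
theorem weight_sections_le (k : Fin 3) {T T' : Finset Letter} (hT : T ⊆ insert (killed k) T')
    (hk : killed k ∈ T) (l : List Letter) :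
    weight T' (sections k l).1 + weight T' (sections k l).2 + countA l ≤
      weight T l + countX l := by
  induction l with
  | nil => simp [weight, sections, countA, countX]
  | cons s l ih =>
    rw [weight_cons]
    by_cases hs : s = Letter.a
    · simp [sections, hs, letterWeight, countA, countX] at ih ⊢
      omega
    · have hx : countX (s :: l) = countX l + 1 := by simp [countX, hs]
      have ha : countA (s :: l) = countA l := by simp [countA, hs]
      rw [hx, ha]
      by_cases hk' : s = killed k
      · have w : letterWeight T s = 2 := by
          simp [letterWeight, hs, hk'.symm ▸ hk]
        have w' : letterWeight T' s ≤ 3 := by unfold letterWeight; split_ifs <;> omega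
        simp only [sections, hs, if_false, if_pos hk', weight_cons]
        omega
      · have w' : letterWeight T' s ≤ letterWeight T s := by
          have : s ∈ T → s ∈ T' := fun h => (Finset.mem_insert.1 (hT h)).resolve_left hk'
          unfold letterWeight
          split_ifs <;> first | omega | tauto
        have wa : letterWeight T' Letter.a = 1 := by simp [letterWeight]
        simp only [sections, hs, if_false, hk', weight_cons, wa]
        omega

/-- Convergence of the weighted growth series of `G_ω` at `exp (-s)`. -/
def Converges (ω : ℕ → Fin 3) (T : Finset Letter) (s : ℝ) : Prop :=
  Summable fun g : GrigorchukGroup ω => Real.exp (-s * norm ω T g)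

theorem Converges.mono {ω : ℕ → Fin 3} {T : Finset Letter} {s t : ℝ} (h : Converges ω T s)
    (hst : s ≤ t) : Converges ω T t := by
  refine Summable.of_nonneg_of_le (fun _ => (Real.exp_pos _).le) (fun g => ?_) h
  refine Real.exp_le_exp.2 (mul_le_mul_of_nonneg_right (by linarith) (Nat.cast_nonneg _))

theorem Converges.of_univ {ω : ℕ → Fin 3} {s : ℝ} (hs : 0 ≤ s) (h : Converges ω Finset.univ s) :
    Converges ω ∅ (3 / 4 * s) := by
  refine Summable.of_nonneg_of_le (fun _ => (Real.exp_pos _).le) (fun g => ?_)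
    (h.mul_left (Real.exp s))
  rw [← Real.exp_add, Real.exp_le_exp]
  have h1 : (4 * norm ω Finset.univ g : ℝ) ≤ 3 * norm ω ∅ g + 4 := mod_cast norm_univ_le ω g
  nlinarith

/-- The growth series over `σω` dominates the one over `ω`. -/
theorem Converges.of_shift {ω : ℕ → Fin 3} {T T' : Finset Letter} {s : ℝ} (hs : 0 ≤ s)
    (hT : T ⊆ insert (killed (ω 0)) T') (hk : killed (ω 0) ∈ T)
    (h : Converges (shift ω) T' s) : Converges ω T s := by
  let Φ : GrigorchukGroup ω →
      Equiv.Perm (Fin 2) × (GrigorchukGroup (shift ω) × GrigorchukGroup (shift ω)) := fun g =>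
    ((recHom (ω 0) (word (minWord ω T g))).right,
      (eval (shift ω) (sections (ω 0) (minWord ω T g)).1,
        eval (shift ω) (sections (ω 0) (minWord ω T g)).2))
  have hΦ : Function.Injective Φ := by
    intro g g' e
    simp only [Φ, Prod.mk.injEq] at e
    rw [← eval_minWord ω T g, ← eval_minWord ω T g', eval_eq_eval_iff]
    exact e
  have h2 := Summable.mul_of_nonneg h h (fun _ => (Real.exp_pos _).le)
    (fun _ => (Real.exp_pos _).le)
  have h3 : Summable fun x : Equiv.Perm (Fin 2) ×
      (GrigorchukGroup (shift ω) × GrigorchukGroup (shift ω)) =>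
      (1 : ℝ) * (Real.exp (-s * norm (shift ω) T' x.2.1) *
        Real.exp (-s * norm (shift ω) T' x.2.2)) :=
    Summable.mul_of_nonneg (f := fun _ : Equiv.Perm (Fin 2) => (1 : ℝ)) (.of_finite) h2
      (fun _ => zero_le_one) (fun _ => mul_nonneg (Real.exp_pos _).le (Real.exp_pos _).le)
  refine Summable.of_nonneg_of_le (fun _ => (Real.exp_pos _).le) (fun g => ?_)
    ((h3.comp_injective hΦ).mul_left (Real.exp s))
  simp only [Function.comp, Φ, one_mul]
  rw [← Real.exp_add, ← Real.exp_add, Real.exp_le_exp]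
  have e1 := weight_sections_le (ω 0) hT hk (minWord ω T g)
  -- Alternation bounds the excess of letters `b, c, d` over `a` by 1; this is the only loss, and it
  -- is absorbed in the factor `exp s`.
  have e2 := (countA_minWord ω T g).2
  have e3 := norm_eval_le (shift ω) T' (sections (ω 0) (minWord ω T g)).1
  have e4 := norm_eval_le (shift ω) T' (sections (ω 0) (minWord ω T g)).2
  have e5 : norm (shift ω) T' (eval (shift ω) (sections (ω 0) (minWord ω T g)).1) +
      norm (shift ω) T' (eval (shift ω) (sections (ω 0) (minWord ω T g)).2) ≤
      norm ω T g + 1 := by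
    have : norm ω T g = weight T (minWord ω T g) := rfl
    omega
  have e6 : ((norm (shift ω) T' (eval (shift ω) (sections (ω 0) (minWord ω T g)).1) : ℝ) +
      norm (shift ω) T' (eval (shift ω) (sections (ω 0) (minWord ω T g)).2)) ≤
      norm ω T g + 1 := mod_cast e5
  nlinarith

/-- Each symbol of the block adds its killed letter to the set of letters of weight 2, at no cost in
`s`. -/
theorem Converges.of_block {s : ℝ} (hs : 0 ≤ s) (m : ℕ) : ∀ ω : ℕ → Fin 3,
    Converges (fun n => ω (n + m)) ∅ s →
    Converges ω ((Finset.range m).image fun i => killed (ω i)) s := by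
  induction m with
  | zero => intro ω h; simpa using h
  | succ m ih =>
    intro ω h
    refine Converges.of_shift hs ?_ ?_ (ih (shift ω) ?_)
    · intro x hx
      obtain ⟨i, hi, rfl⟩ := Finset.mem_image.1 hx
      cases i with
      | zero => exact Finset.mem_insert_self _ _
      | succ i =>
        refine Finset.mem_insert_of_mem (Finset.mem_image.2 ⟨i, ?_, rfl⟩)
        simpa using hi
    · exact Finset.mem_image.2 ⟨0, by simp, rfl⟩
    · exact h

/-- Needed because the killed letters never include `a`, whereas `Finset.univ` does. -/
theorem weight_eq_of_subset {T T' : Finset Letter} (h : ∀ s ≠ Letter.a, (s ∈ T ↔ s ∈ T')) :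
    letterWeight T = letterWeight T' := by
  funext s
  unfold letterWeight
  by_cases hs : s = Letter.a
  · simp [hs]
  · simp [h s hs]

theorem summable_pow_length {x : ℝ} (h0 : 0 ≤ x) (h1 : 4 * x < 1) :
    Summable fun l : List Letter => x ^ l.length := by
  rw [← (Equiv.sigmaFiberEquiv (List.length (α := Letter))).summable_iff]
  refine (summable_sigma_of_nonneg fun _ => pow_nonneg h0 _).2 ?_
  have hc : ∀ n, Finite {l : List Letter // l.length = n} := fun n =>
    inferInstanceAs (Finite (List.Vector Letter n))
  refine ⟨fun n => Summable.of_finite, ?_⟩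
  have : ∀ n, ∑' y : {l : List Letter // l.length = n},
      x ^ ((Equiv.sigmaFiberEquiv (List.length (α := Letter))) ⟨n, y⟩).length = (4 * x) ^ n := by
    intro n
    have e : ∀ y : {l : List Letter // l.length = n},
      x ^ ((Equiv.sigmaFiberEquiv (List.length (α := Letter))) ⟨n, y⟩).length = x ^ n := by
      rintro ⟨l, rfl⟩
      rfl
    simp only [e]
    rw [tsum_const, nsmul_eq_mul, mul_pow]
    congr 1
    have : Nat.card (List.Vector Letter n) = 4 ^ n := by
      rw [Nat.card_eq_fintype_card, card_vector]
      rfl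
    exact_mod_cast this
  simp only [this]
  exact summable_geometric_of_lt_one (by linarith) h1

theorem converges_of_large (ω : ℕ → Fin 3) (T : Finset Letter) : Converges ω T 2 := by
  have h : Summable fun l : List Letter => Real.exp (-2) ^ l.length := by
    refine summable_pow_length (Real.exp_pos _).le ?_
    -- The exponent 2 suffices because there are `4 ^ n` words of length `n` and `4 < exp 2`.
    have h1 := Real.exp_one_gt_d9
    have : Real.exp 2 = Real.exp 1 * Real.exp 1 := by rw [← Real.exp_add]; norm_num
    rw [Real.exp_neg, ← div_eq_mul_inv, div_lt_one (Real.exp_pos _), this]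
    nlinarith
  have hinj : Function.Injective (minWord ω T) := fun g g' e => by
    rw [← eval_minWord ω T g, e, eval_minWord]
  refine Summable.of_nonneg_of_le (fun _ => (Real.exp_pos _).le) (fun g => ?_)
    (h.comp_injective hinj)
  simp only [Function.comp]
  rw [← Real.exp_nat_mul, Real.exp_le_exp]
  have : ((minWord ω T g).length : ℝ) ≤ norm ω T g := mod_cast length_le_weight T _
  linarith

theorem infinite_shift {ω : ℕ → Fin 3} (hω : ∀ k : Fin 3, {n : ℕ | ω n = k}.Infinite) (m : ℕ) :
    ∀ k : Fin 3, {n : ℕ | ω (n + m) = k}.Infinite := by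
  intro k
  rw [← Nat.frequently_atTop_iff_infinite] at *
  rw [Filter.frequently_atTop]
  intro N
  obtain ⟨n, hn, h⟩ := (Nat.frequently_atTop_iff_infinite.2 (hω k)).forall_exists_of_atTop (N + m)
  exact ⟨n - m, by omega, by rw [← h]; congr 1; omega⟩

theorem converges_pow (j : ℕ) : ∀ ω : ℕ → Fin 3, (∀ k : Fin 3, {n : ℕ | ω n = k}.Infinite) →
    Converges ω ∅ ((3 / 4) ^ j * 2) := by
  induction j with
  | zero => intro ω _; simpa using converges_of_large ω ∅
  | succ j ih =>
    intro ω hω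
    choose f hf using fun k => (hω k).nonempty
    -- Long enough for every symbol to occur among the first `m`.
    set m := f 0 + f 1 + f 2 + 1 with hm
    have hs : (0 : ℝ) ≤ (3 / 4) ^ j * 2 := by positivity
    have h := Converges.of_block hs m ω (ih _ (infinite_shift hω m))
    have hT : letterWeight ((Finset.range m).image fun i => killed (ω i)) =
        letterWeight Finset.univ := by
      refine weight_eq_of_subset fun s hs => iff_of_true ?_ (Finset.mem_univ s)
      have key : ∀ k : Fin 3, killed k ∈ (Finset.range m).image fun i => killed (ω i) := by
        intro k
        refine Finset.mem_image.2 ⟨f k, ?_, congrArg killed (hf k)⟩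
        rw [Finset.mem_range]
        fin_cases k <;> simp <;> omega
      cases s
      · exact absurd rfl hs
      · exact key 0
      · exact key 1
      · exact key 2
    have h' : Converges ω Finset.univ ((3 / 4) ^ j * 2) := by
      refine Summable.of_nonneg_of_le (fun _ => (Real.exp_pos _).le) (fun g => ?_) h
      rw [Real.exp_le_exp]
      have h1 := norm_eval_le ω ((Finset.range m).image fun i => killed (ω i))
        (minWord ω Finset.univ g)
      rw [eval_minWord, weight, hT] at h1
      have h2 : (norm ω ((Finset.range m).image fun i => killed (ω i)) g : ℝ) ≤
        norm ω Finset.univ g := mod_cast h1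
      nlinarith
    have := Converges.of_univ hs h'
    rw [pow_succ]
    convert this using 1
    ring

theorem converges_of_pos {ω : ℕ → Fin 3} (hω : ∀ k : Fin 3, {n : ℕ | ω n = k}.Infinite) {s : ℝ}
    (hs : 0 < s) : Converges ω ∅ s := by
  obtain ⟨j, hj⟩ := exists_pow_lt_of_lt_one (half_pos hs) (by norm_num : (3 / 4 : ℝ) < 1)
  exact (converges_pow j ω hω).mono (by linarith)

/-- The elements of `G_ω` spelled by words of length at most `n`. -/
def letterBall (ω : ℕ → Fin 3) (n : ℕ) : Set (GrigorchukGroup ω) :=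
  eval ω '' {l | l.length ≤ n}

theorem finite_letterBall (ω : ℕ → Fin 3) (n : ℕ) : (letterBall ω n).Finite :=
  (List.finite_length_le Letter n).image _

/-- The growth of `G_ω` is subexponential. -/
theorem ncard_letterBall_le {ω : ℕ → Fin 3} (hω : ∀ k : Fin 3, {n : ℕ | ω n = k}.Infinite)
    {s : ℝ} (hs : 0 < s) :
    ∃ K : ℝ, 0 < K ∧ ∀ n : ℕ, ((letterBall ω n).ncard : ℝ) ≤ K * Real.exp (s * n) := by
  -- A word of length `n` weighs at most `3n`, so each element of the ball contributes at least `exp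
  -- (-s * n)` to the series.
  have h := converges_of_pos hω (s := s / 3) (by linarith)
  refine ⟨∑' g, Real.exp (-(s / 3) * norm ω ∅ g), ?_, fun n => ?_⟩
  · exact h.tsum_pos (fun _ => (Real.exp_pos _).le) 1 (Real.exp_pos _)
  · rw [← div_le_iff₀ (Real.exp_pos _), div_eq_mul_inv, ← Real.exp_neg]
    have hf := finite_letterBall ω n
    rw [Set.ncard_eq_toFinset_card _ hf, ← nsmul_eq_mul]
    refine le_trans ?_ (h.sum_le_tsum hf.toFinset (fun _ _ => (Real.exp_pos _).le))
    refine Finset.card_nsmul_le_sum _ _ _ fun g hg => ?_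
    obtain ⟨l, hl, rfl⟩ := hf.mem_toFinset.1 hg
    rw [Real.exp_le_exp]
    have h1 : norm ω ∅ (eval ω l) ≤ 3 * n :=
      (norm_eval_le ω ∅ l).trans ((weight_le_length ∅ l).trans (Nat.mul_le_mul_left 3 hl))
    have h2 : (norm ω ∅ (eval ω l) : ℝ) ≤ 3 * n := mod_cast h1
    nlinarith

end Grigorchuk

/-! ### Lower bound: finite dihedral subgroups and lifting of words. -/

namespace Grigorchuk

/-- Since `x` inverts `xy`, the finite set `⟨xy⟩ ∪ ⟨xy⟩x` is stable under left multiplication by `x`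
and by `y = x(xy)`. -/
theorem finite_closure_pair {H : Type*} [Group H] {x y : H} (hx : x * x = 1) (hy : y * y = 1)
    (h : IsOfFinOrder (x * y)) : Finite (Subgroup.closure {x, y}) := by
  have hx' : x⁻¹ = x := inv_eq_of_mul_eq_one_left hx
  have hy' : y⁻¹ = y := inv_eq_of_mul_eq_one_left hy
  have hfin : ((Subgroup.zpowers (x * y) : Set H) ∪
      (fun z => z * x) '' (Subgroup.zpowers (x * y) : Set H)).Finite := by
    have : (Subgroup.zpowers (x * y) : Set H).Finite := finite_zpowers.2 h
    exact this.union (this.image _)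
  have comm : ∀ i : ℤ, x * (x * y) ^ i = (x * y) ^ (-i) * x := by
    intro i
    have hs : SemiconjBy x (x * y) (x * y)⁻¹ := by
      simp [SemiconjBy, hx', hy', mul_assoc, hx]
      rw [← mul_assoc, hx, one_mul]
    have := hs.zpow_right i
    rwa [inv_zpow', SemiconjBy] at this
  have hxmem : ∀ g, g ∈ ((Subgroup.zpowers (x * y) : Set H) ∪
      (fun z => z * x) '' (Subgroup.zpowers (x * y) : Set H)) →
      x * g ∈ ((Subgroup.zpowers (x * y) : Set H) ∪
      (fun z => z * x) '' (Subgroup.zpowers (x * y) : Set H)) := by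
    rintro g (⟨i, rfl⟩ | ⟨_, ⟨i, rfl⟩, rfl⟩)
    · exact Or.inr ⟨_, ⟨-i, rfl⟩, (comm i).symm⟩
    · refine Or.inl ⟨-i, ?_⟩
      simp only
      rw [← mul_assoc, comm, mul_assoc, hx, mul_one]
  have hymem : ∀ g, g ∈ ((Subgroup.zpowers (x * y) : Set H) ∪
      (fun z => z * x) '' (Subgroup.zpowers (x * y) : Set H)) →
      y * g ∈ ((Subgroup.zpowers (x * y) : Set H) ∪
      (fun z => z * x) '' (Subgroup.zpowers (x * y) : Set H)) := by
    intro g hg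
    have e : y * g = x * ((x * y) * g) := by rw [← mul_assoc, ← mul_assoc, hx, one_mul]
    rw [e]
    refine hxmem _ ?_
    have hm := Subgroup.mem_zpowers (x * y)
    rcases hg with hg | ⟨z, hz, rfl⟩
    · exact Or.inl (mul_mem hm hg)
    · exact Or.inr ⟨x * y * z, mul_mem hm hz, by simp [mul_assoc]⟩
  refine (hfin.subset fun g hg => ?_).to_subtype
  induction hg using Subgroup.closure_induction_left with
  | one => exact Or.inl (one_mem _)
  | mul_left z hz g _ hg =>
    rcases hz with rfl | rfl
    · exact hxmem _ hg
    · exact hymem _ hg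
  | inv_mul_cancel z hz g _ hg =>
    rcases hz with rfl | rfl
    · rw [hx']; exact hxmem _ hg
    · rw [hy']; exact hymem _ hg

theorem mul_left_of_right_eq_one {H : Type*} [Group H] {x : Wreath H} (hx : x.right = 1)
    (y : Wreath H) : (x * y).left = x.left * y.left ∧ (x * y).right = y.right := by
  simp [SemidirectProduct.mul_left, hx]

theorem pow_left_of_right_eq_one {H : Type*} [Group H] {x : Wreath H} (hx : x.right = 1)
    (n : ℕ) : (x ^ n).left = x.left ^ n ∧ (x ^ n).right = 1 := by
  induction n with
  | zero => simp
  | succ n ih =>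
    rw [pow_succ', pow_succ']
    obtain ⟨h1, h2⟩ := mul_left_of_right_eq_one hx (x ^ n)
    rw [h1, h2, ih.1]
    exact ⟨rfl, ih.2⟩

theorem recHom_sq (k : Fin 3) {x : Letter} (hx : x ≠ Letter.a) :
    (recHom k ((gen Letter.a * gen x) ^ 2)).right = 1 ∧
    (recHom k ((gen Letter.a * gen x) ^ 2)).left 0 =
      gen x * (if x = killed k then 1 else gen Letter.a) ∧
    (recHom k ((gen Letter.a * gen x) ^ 2)).left 1 =
      (if x = killed k then 1 else gen Letter.a) * gen x := by
  have e : (gen Letter.a * gen x) ^ 2 = gen Letter.a * (gen x * (gen Letter.a * (gen x * 1))) := by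
    simp [pow_two, mul_assoc]
  obtain ⟨r1, l1, m1⟩ := recHom_of_ne_a k x hx 1
  obtain ⟨r2, l2, m2⟩ := recHom_a k (gen x * 1)
  obtain ⟨r3, l3, m3⟩ := recHom_of_ne_a k x hx (gen Letter.a * (gen x * 1))
  obtain ⟨r4, l4, m4⟩ := recHom_a k (gen x * (gen Letter.a * (gen x * 1)))
  rw [e, r4, r3, r2, r1, l4, m4, m3, l3, l2, m2, l1, m1]
  simp

/-- The product of `a` with the letter killed by `k` has finite order once `k` occurs. -/
theorem a_mul_killed_pow (k : Fin 3) (n : ℕ) : ∀ ω : ℕ → Fin 3, ω n = k →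
    (((gen Letter.a * gen (killed k)) ^ 2 ^ (n + 2) : F) : GrigorchukGroup ω) = 1 := by
  have hx : killed k ≠ Letter.a := by fin_cases k <;> simp [killed]
  have sq : ∀ n : ℕ, gen (killed k) ^ 2 ^ (n + 1) = 1 := by
    intro n
    rw [pow_succ', pow_mul, pow_two, gen_mul_self, one_pow]
  -- For `x = killed k`, the square of `ax` has sections `x, x` if `ω 0 = k`, and `xa, ax`
  -- otherwise. So each level either ends at an involution or halves the exponent and shifts `ω`.
  have main : ∀ (n : ℕ) (ω : ℕ → Fin 3),
      (ω 0 ≠ k → (((gen Letter.a * gen (killed k)) ^ 2 ^ (n + 1) : F) :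
        GrigorchukGroup (shift ω)) = 1) →
      (((gen Letter.a * gen (killed k)) ^ 2 ^ (n + 2) : F) : GrigorchukGroup ω) = 1 := by
    intro n ω h
    obtain ⟨h1, h2, h3⟩ := recHom_sq (ω 0) hx
    obtain ⟨h4, h5⟩ := pow_left_of_right_eq_one h1 (2 ^ (n + 1))
    rw [← QuotientGroup.mk_one, mk_eq_mk_iff, pow_succ' 2, pow_mul, map_pow, h4, h5, map_one]
    refine ⟨rfl, ?_⟩
    rw [Fin.forall_fin_two, Pi.pow_apply, Pi.pow_apply, h2, h3]
    by_cases hk : ω 0 = k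
    · simp only [hk, if_true, one_mul, mul_one, sq]
      exact ⟨rfl, rfl⟩
    · have hk' : killed k ≠ killed (ω 0) := by
        generalize ω 0 = i at hk
        revert hk
        fin_cases k <;> fin_cases i <;> simp [killed]
      rw [if_neg hk']
      refine ⟨?_, h hk⟩
      have e : gen (killed k) * gen Letter.a = (gen Letter.a * gen (killed k))⁻¹ := by
        rw [mul_inv_rev, gen_inv, gen_inv]
      rw [e, inv_pow, QuotientGroup.mk_inv, h hk, inv_one]
      rfl
  induction n with
  | zero => intro ω h; exact main 0 ω fun h' => absurd h h'
  | succ n ih => intro ω h; exact main (n + 1) ω fun _ => ih (shift ω) h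

/-- The subgroup of `G_ω` generated by `a` and the letter `u`. -/
def dihedral (ω : ℕ → Fin 3) (u : Letter) : Subgroup (GrigorchukGroup ω) :=
  Subgroup.closure {eval ω [Letter.a], eval ω [u]}

theorem finite_dihedral {ω : ℕ → Fin 3} (hω : ∀ k : Fin 3, {n : ℕ | ω n = k}.Infinite)
    {u : Letter} (hu : u ≠ Letter.a) : Finite (dihedral ω u) := by
  obtain ⟨k, rfl⟩ : ∃ k, u = killed k := by
    cases u
    · exact absurd rfl hu
    · exact ⟨0, rfl⟩
    · exact ⟨1, rfl⟩
    · exact ⟨2, rfl⟩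
  have sq : ∀ s, eval ω [s] * eval ω [s] = 1 := by
    intro s
    rw [← eval_append]
    simp [eval, gen_mul_self]
  obtain ⟨n, hn⟩ := (hω k).nonempty
  refine finite_closure_pair (sq _) (sq _) (isOfFinOrder_iff_pow_eq_one.2
    ⟨2 ^ (n + 2), by positivity, ?_⟩)
  rw [← a_mul_killed_pow k n ω hn, ← eval_append]
  simp [eval]

/-- The word obtained by replacing each letter `a` by `aua`. If `u` is not killed by `k`, its
section at `1` is the original word. -/
def lift (u : Letter) : List Letter → List Letter
  | [] => []
  | s :: l => if s = Letter.a then Letter.a :: u :: Letter.a :: lift u l else s :: lift u l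

theorem length_lift_le (u : Letter) (l : List Letter) : (lift u l).length ≤ 3 * l.length := by
  induction l with
  | nil => simp [lift]
  | cons s l ih =>
    rw [lift]
    split_ifs <;> simp <;> omega

/-- `aua` acts as `(u, a)` and each `x` among `b, c, d` as `(1, x)` or `(a, x)`, so coordinate 0
only ever sees `a` and `u`. -/
theorem recHom_lift {k : Fin 3} {u : Letter} (hu : u ≠ Letter.a) (hk : u ≠ killed k)
    (ω : ℕ → Fin 3) (l : List Letter) :
    (recHom k (word (lift u l))).right = 1 ∧
    (((recHom k (word (lift u l))).left 0 : F) : GrigorchukGroup ω) ∈ dihedral ω u ∧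
    (recHom k (word (lift u l))).left 1 = word l := by
  have ha : eval ω [Letter.a] ∈ dihedral ω u := Subgroup.subset_closure (by simp)
  have hu' : eval ω [u] ∈ dihedral ω u := Subgroup.subset_closure (by simp)
  simp only [eval, word_cons, word_nil, mul_one] at ha hu'
  induction l with
  | nil => simp [lift, one_mem]
  | cons s l ih =>
    obtain ⟨h1, h2, h3⟩ := ih
    rw [lift]
    by_cases hs : s = Letter.a
    · rw [if_pos hs, word_cons, word_cons, word_cons]
      obtain ⟨r1, l1, m1⟩ := recHom_a k (word (lift u l))
      obtain ⟨r2, l2, m2⟩ := recHom_of_ne_a k u hu (gen Letter.a * word (lift u l))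
      obtain ⟨r3, l3, m3⟩ := recHom_a k (gen u * (gen Letter.a * word (lift u l)))
      rw [r3, l3, m3, r2, l2, m2, r1, l1, m1, h1, h3, if_neg hk, hs, word_cons]
      exact ⟨by simp, by rw [QuotientGroup.mk_mul]; exact mul_mem hu' h2, rfl⟩
    · rw [if_neg hs, word_cons]
      obtain ⟨r1, l1, m1⟩ := recHom_of_ne_a k s hs (word (lift u l))
      rw [r1, l1, m1, h3, word_cons]
      refine ⟨h1, ?_, rfl⟩
      rw [QuotientGroup.mk_mul]
      refine mul_mem ?_ h2
      split_ifs
      · exact one_mem _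
      · exact ha

theorem exists_letter_ne_killed (k : Fin 3) : ∃ u, u ≠ Letter.a ∧ u ≠ killed k := by
  fin_cases k
  · exact ⟨Letter.c, by nofun, by nofun⟩
  · exact ⟨Letter.d, by nofun, by nofun⟩
  · exact ⟨Letter.b, by nofun, by nofun⟩

theorem recHom_conj_a {k : Fin 3} {g : F} (hg : (recHom k g).right = 1) :
    (recHom k (gen Letter.a * (g * gen Letter.a))).right = 1 ∧
    (recHom k (gen Letter.a * (g * gen Letter.a))).left 0 = (recHom k g).left 1 ∧
    (recHom k (gen Letter.a * (g * gen Letter.a))).left 1 = (recHom k g).left 0 := by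
  obtain ⟨r1, l1, m1⟩ := recHom_a k (g * gen Letter.a)
  obtain ⟨r2, l2, m2⟩ := recHom_a k 1
  obtain ⟨h1, h2⟩ := mul_left_of_right_eq_one hg (recHom k (gen Letter.a))
  rw [mul_one] at r2 l2 m2
  rw [r1, l1, m1, map_mul, h1, h2, Pi.mul_apply, Pi.mul_apply, r2, l2, m2]
  simp

theorem exists_word_of_mem_letterBall {ω : ℕ → Fin 3} {n : ℕ} (g : letterBall ω n) :
    ∃ l : List Letter, l.length ≤ n ∧ eval ω l = g := g.2

theorem eval_mem_letterBall (ω : ℕ → Fin 3) {n : ℕ} {l : List Letter} (h : l.length ≤ n) :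
    eval ω l ∈ letterBall ω n := ⟨l, h, rfl⟩

/-- Lifts fix the two coordinates, and a further `a` in front swaps them, so lifts with and without
it never coincide. -/
theorem two_mul_ncard_letterBall_le (ω : ℕ → Fin 3) (n : ℕ) :
    2 * (letterBall (shift ω) n).ncard ≤ (letterBall ω (3 * n + 1)).ncard := by
  obtain ⟨u, hu, hk⟩ := exists_letter_ne_killed (ω 0)
  choose w hw he using exists_word_of_mem_letterBall (ω := shift ω) (n := n)
  have hf := finite_letterBall ω (3 * n + 1)
  have : Finite (letterBall ω (3 * n + 1)) := hf.to_subtype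
  let f : Bool × letterBall (shift ω) n → letterBall ω (3 * n + 1) := fun p =>
    ⟨eval ω ((if p.1 then [Letter.a] else []) ++ lift u (w p.2)), eval_mem_letterBall ω (by
      have h1 := length_lift_le u (w p.2)
      have h2 := hw p.2
      rw [List.length_append]
      split_ifs <;> simp <;> omega)⟩
  have key : ∀ h, (recHom (ω 0) (word (lift u (w h)))).right = 1 ∧
      (((recHom (ω 0) (word (lift u (w h)))).left 1 : F) : GrigorchukGroup (shift ω)) = h := by
    intro h
    obtain ⟨h1, -, h3⟩ := recHom_lift hu hk (shift ω) (w h)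
    exact ⟨h1, by rw [h3]; exact he h⟩
  have hinj : Function.Injective f := by
    rintro ⟨b, h⟩ ⟨b', h'⟩ e
    have e' := congrArg Subtype.val e
    simp only [f, eval] at e'
    rw [mk_eq_mk_iff] at e'
    obtain ⟨r, m⟩ := key h
    obtain ⟨r', m'⟩ := key h'
    obtain ⟨q1, -, q3⟩ := recHom_a (ω 0) (word (lift u (w h)))
    obtain ⟨q1', -, q3'⟩ := recHom_a (ω 0) (word (lift u (w h')))
    have hne : (Equiv.swap 0 1 : Equiv.Perm (Fin 2)) ≠ 1 := by decide
    cases b <;> cases b'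
    · have := e'.2 1
      simp only [Bool.false_eq_true, if_false, List.nil_append] at this
      rw [m, m'] at this
      rw [Subtype.ext this]
    · have := e'.1
      simp only [Bool.false_eq_true, if_false, if_true, List.nil_append, List.cons_append,
        word_cons] at this
      rw [q1', r, r', mul_one] at this
      exact absurd this.symm hne
    · have := e'.1
      simp only [Bool.false_eq_true, if_false, if_true, List.nil_append, List.cons_append,
        word_cons] at this
      rw [q1, r, r', mul_one] at this
      exact absurd this hne
    · have := e'.2 0
      simp only [if_true, List.nil_append, List.cons_append, word_cons] at this
      rw [(recHom_a _ _).2.1, (recHom_a _ _).2.1, m, m'] at this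
      rw [Subtype.ext this]
  have := Nat.card_le_card_of_injective f hinj
  simpa [Nat.card_prod] using this

/-- Multiply a lift of `h` by the `a`-conjugate of a lift of `g`: the coordinates are `d * g` and `h
* d'` with `d, d'` dihedral. Recording `d` and `d'` as well makes the pair recoverable, so `M` is
the square of the dihedral order. -/
theorem exists_sq_ncard_letterBall_le {ω : ℕ → Fin 3}
    (hω : ∀ k : Fin 3, {n : ℕ | ω n = k}.Infinite) :
    ∃ M : ℕ, 0 < M ∧ ∀ n, (letterBall (shift ω) n).ncard ^ 2 ≤
      M * (letterBall ω (6 * n + 2)).ncard := by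
  obtain ⟨u, hu, hk⟩ := exists_letter_ne_killed (ω 0)
  have hD : Finite (dihedral (shift ω) u) := finite_dihedral (infinite_shift hω 1) hu
  refine ⟨Nat.card (dihedral (shift ω) u × dihedral (shift ω) u), Nat.card_pos, fun n => ?_⟩
  choose w hw he using exists_word_of_mem_letterBall (ω := shift ω) (n := n)
  have hf := finite_letterBall ω (6 * n + 2)
  have : Finite (letterBall ω (6 * n + 2)) := hf.to_subtype
  have spec := fun h => recHom_lift hu hk (shift ω) (w h)
  let f : letterBall (shift ω) n × letterBall (shift ω) n →
      (dihedral (shift ω) u × dihedral (shift ω) u) × letterBall ω (6 * n + 2) := fun p =>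
    ((⟨_, (spec p.1).2.1⟩, ⟨_, (spec p.2).2.1⟩),
      ⟨eval ω (lift u (w p.1) ++ (Letter.a :: (lift u (w p.2) ++ [Letter.a]))),
        eval_mem_letterBall ω (by
          have h1 := length_lift_le u (w p.1)
          have h2 := hw p.1
          have h3 := length_lift_le u (w p.2)
          have h4 := hw p.2
          simp
          omega)⟩)
  have hinj : Function.Injective f := by
    rintro ⟨h, g⟩ ⟨h', g'⟩ e
    simp only [f, Prod.mk.injEq, Subtype.mk.injEq] at e
    obtain ⟨⟨e1, e2⟩, e3⟩ := e
    simp only [eval, word_append, word_cons, word_nil, mul_one] at e3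
    rw [mk_eq_mk_iff, map_mul _ (word (lift u (w h))), map_mul _ (word (lift u (w h'))),
      (mul_left_of_right_eq_one (spec h).1 _).1,
      (mul_left_of_right_eq_one (spec h').1 _).1, Fin.forall_fin_two] at e3
    obtain ⟨-, e4, e5⟩ := e3
    simp only [Pi.mul_apply, QuotientGroup.mk_mul] at e4 e5
    obtain ⟨-, c0, c1⟩ := recHom_conj_a (spec g).1
    obtain ⟨-, c0', c1'⟩ := recHom_conj_a (spec g').1
    rw [c0, c0', e1, (spec g).2.2, (spec g').2.2] at e4
    rw [c1, c1', e2, (spec h).2.2, (spec h').2.2] at e5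
    have hg := mul_left_cancel e4
    have hh := mul_right_cancel e5
    change eval (shift ω) (w g) = eval (shift ω) (w g') at hg
    change eval (shift ω) (w h) = eval (shift ω) (w h') at hh
    rw [he, he] at hg hh
    rw [Subtype.ext hg, Subtype.ext hh]
  have := Nat.card_le_card_of_injective f hinj
  simp only [Nat.card_prod, Nat.card_coe_set_eq] at this ⊢
  rw [pow_two]
  exact this

theorem letterBall_mono (ω : ℕ → Fin 3) : Monotone fun n => (letterBall ω n).ncard :=
  fun _ n h => Set.ncard_le_ncard (Set.image_mono fun _ hl => le_trans hl h)
    (finite_letterBall ω n)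

theorem one_le_ncard_letterBall (ω : ℕ → Fin 3) (n : ℕ) : 1 ≤ (letterBall ω n).ncard :=
  (Set.ncard_pos (finite_letterBall ω n)).2 ⟨1, [], by simp, rfl⟩

theorem two_pow_le_ncard_letterBall (j : ℕ) : ∀ ω : ℕ → Fin 3,
    2 ^ j ≤ (letterBall ω (4 ^ j)).ncard := by
  induction j with
  | zero => intro ω; exact one_le_ncard_letterBall ω _
  | succ j ih =>
    intro ω
    have h1 := two_mul_ncard_letterBall_le ω (4 ^ j)
    have h2 := letterBall_mono ω (show 3 * 4 ^ j + 1 ≤ 4 ^ (j + 1) by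
      have := Nat.one_le_pow j 4 (by norm_num); omega)
    have h3 := ih (shift ω)
    simp only at h2
    omega

/-- The square on the right lets the induction start from `√n` growth, provided by
`two_pow_le_ncard_letterBall`. Each use of the squaring inequality doubles the exponent. -/
theorem pow_le_sq_ncard_letterBall (j : ℕ) : ∀ ω : ℕ → Fin 3,
    (∀ k : Fin 3, {n : ℕ | ω n = k}.Infinite) →
    ∃ K : ℕ, 0 < K ∧ ∀ n, n ^ 2 ^ j ≤ K * (letterBall ω n).ncard ^ 2 := by
  induction j with
  | zero =>
    intro ω _
    refine ⟨4, by norm_num, fun n => ?_⟩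
    rcases Nat.eq_zero_or_pos n with rfl | hn
    · simp
    · have h1 : 4 ^ Nat.log 4 n ≤ n := Nat.pow_log_le_self 4 hn.ne'
      have h2 : n < 4 ^ (Nat.log 4 n + 1) := Nat.lt_pow_succ_log_self (by norm_num) n
      have h3 := (two_pow_le_ncard_letterBall (Nat.log 4 n) ω).trans (letterBall_mono ω h1)
      have h4 := Nat.pow_le_pow_left h3 2
      have h5 : (2 ^ Nat.log 4 n) ^ 2 = 4 ^ Nat.log 4 n := by
        rw [← pow_mul, mul_comm, pow_mul]; norm_num
      rw [h5] at h4
      rw [pow_succ] at h2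
      simp only at h4
      simp
      omega
  | succ j ih =>
    intro ω hω
    obtain ⟨K, hK, h⟩ := ih (shift ω) (infinite_shift hω 1)
    obtain ⟨M, hM, h'⟩ := exists_sq_ncard_letterBall_le hω
    refine ⟨(14 ^ 2 ^ j * (K * M)) ^ 2, by positivity, fun n => ?_⟩
    have h0 := one_le_ncard_letterBall ω n
    rw [← mul_pow, pow_succ, pow_mul]
    refine Nat.pow_le_pow_left ?_ 2
    rcases lt_or_ge n 14 with hn | hn
    · calc n ^ 2 ^ j ≤ 14 ^ 2 ^ j := Nat.pow_le_pow_left hn.le _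
        _ ≤ _ := by
          rw [mul_assoc]
          exact Nat.le_mul_of_pos_right _ (by positivity)
    -- `(n - 2) / 6` is the largest radius whose lifted pairs stay in the ball of radius `n`.
    · have e : n ≤ 14 * ((n - 2) / 6) := by omega
      have h1 := h ((n - 2) / 6)
      have h2 := h' ((n - 2) / 6)
      have h3 := letterBall_mono ω (show 6 * ((n - 2) / 6) + 2 ≤ n by omega)
      simp only at h3
      calc n ^ 2 ^ j ≤ (14 * ((n - 2) / 6)) ^ 2 ^ j := Nat.pow_le_pow_left e _
        _ = 14 ^ 2 ^ j * ((n - 2) / 6) ^ 2 ^ j := mul_pow _ _ _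
        _ ≤ 14 ^ 2 ^ j * (K * (M * (letterBall ω n).ncard)) := by
          gcongr
          exact h1.trans (Nat.mul_le_mul_left K (h2.trans (Nat.mul_le_mul_left M h3)))
        _ = _ := by ring

end Grigorchuk

/-! ### From numerical bounds to intermediate type. -/

namespace WordGrowth

theorem ball_mono {G : Type*} [Group G] (S : Finset G) {R R' : ℝ} (h : R ≤ R') :
    ball S R ⊆ ball S R' :=
  fun _ ⟨l, h1, h2, h3⟩ => ⟨l, h1, h2.trans h, h3⟩

/-- A growth function exceeding every power and subexponential is of intermediate type. -/
theorem isIntermediate_of_bounds {v : ℝ → ℝ}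
    (lower : ∀ d : ℕ, ∃ L > 0, ∃ C > 0, ∀ R : ℝ, 1 ≤ R → R ^ d ≤ C * v (L * R))
    (upper : ∀ s : ℝ, 0 < s → ∃ K > 0, ∀ R : ℝ, 0 ≤ R → v R ≤ K * Real.exp (s * R)) :
    IsIntermediate v := by
  refine ⟨fun d => ⟨?_, ?_⟩, ?_, ?_⟩
  -- The spare factor `R` absorbs the constant `C`.
  · obtain ⟨L, hL, C, hC, h⟩ := lower (d + 1)
    refine ⟨L, hL, ?_⟩
    filter_upwards [Filter.eventually_ge_atTop 1, Filter.eventually_ge_atTop C] with R h1 h2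
    have h3 := h R h1
    have h4 : C * R ^ d ≤ C * v (L * R) := by
      refine le_trans ?_ h3
      rw [pow_succ']
      exact mul_le_mul_of_nonneg_right h2 (by positivity)
    exact le_of_mul_le_mul_left h4 hC
  · rintro ⟨A, hA, hev⟩
    obtain ⟨L, hL, C, hC, h⟩ := lower (d + 1)
    have hev' := (Filter.tendsto_id.const_mul_atTop hL).eventually hev
    obtain ⟨R, h1, h2, h3⟩ := ((Filter.eventually_ge_atTop 1).and
      ((Filter.eventually_gt_atTop (C * (A * L) ^ d)).and hev')).exists
    have h4 := h R h1
    simp only [id] at h3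
    have h5 : R * R ^ d ≤ C * (A * L) ^ d * R ^ d := by
      rw [← pow_succ', mul_assoc, ← mul_pow, mul_assoc A]
      exact h4.trans (mul_le_mul_of_nonneg_left h3 hC.le)
    exact absurd (le_of_mul_le_mul_right h5 (by positivity)) (not_le.2 h2)
  · obtain ⟨K, hK, h⟩ := upper 1 one_pos
    refine ⟨2, two_pos, ?_⟩
    filter_upwards [Filter.eventually_ge_atTop 0, Filter.eventually_ge_atTop (Real.log K)]
      with R h1 h2
    refine (h R h1).trans ?_
    rw [one_mul, two_mul, Real.exp_add]
    exact mul_le_mul_of_nonneg_right ((Real.log_le_iff_le_exp hK).1 h2) (Real.exp_pos _).le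
  · rintro ⟨A, hA, hev⟩
    -- At the argument `A * R` this rate gives only `exp (R / 2)`, which no constant `K` lifts to
    -- `exp R` for large `R`.
    obtain ⟨K, hK, h⟩ := upper (1 / (2 * A)) (by positivity)
    obtain ⟨R, h1, h2, h3⟩ := ((Filter.eventually_ge_atTop 0).and
      ((Filter.eventually_gt_atTop (2 * Real.log K)).and hev)).exists
    have h4 := h3.trans (h (A * R) (by positivity))
    have e : 1 / (2 * A) * (A * R) = R / 2 := by field_simp
    have h5 : Real.exp R = Real.exp (R / 2) * Real.exp (R / 2) := by
      rw [← Real.exp_add]; congr 1; ring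
    rw [e, h5] at h4
    have h6 := le_of_mul_le_mul_right h4 (Real.exp_pos _)
    have h7 := (Real.le_log_iff_exp_le hK).2 h6
    linarith

end WordGrowth

/-! ### Passage to arbitrary finite generating sets. -/

namespace Grigorchuk

open WordGrowth

theorem exists_letterBall_subset_ball (ω : ℕ → Fin 3) {S : Finset (GrigorchukGroup ω)}
    (hS : Subgroup.closure (S : Set (GrigorchukGroup ω)) = ⊤) :
    ∃ L : ℕ, 0 < L ∧ ∀ n, letterBall ω n ⊆ ball S ((L * n : ℕ) : ℝ) := by
  have key : ∀ s : Letter, ∃ m : List (GrigorchukGroup ω),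
      (∀ y ∈ m, y ∈ S ∨ y⁻¹ ∈ S) ∧ m.prod = eval ω [s] := fun s => by
    have hs : eval ω [s] ∈ (Subgroup.closure (S : Set (GrigorchukGroup ω))).toSubmonoid := by
      rw [hS]; trivial
    rw [Subgroup.closure_toSubmonoid] at hs
    obtain ⟨m, hm, e⟩ := Submonoid.exists_list_of_mem_closure hs
    exact ⟨m, fun y hy => by simpa using hm y hy, e⟩
  choose f hf he using key
  refine ⟨∑ s, (f s).length + 1, Nat.succ_pos _, fun n => ?_⟩
  rintro _ ⟨l, hl, rfl⟩
  refine ⟨l.flatMap f, fun y hy => ?_, ?_, ?_⟩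
  · obtain ⟨s, -, hs⟩ := List.mem_flatMap.1 hy
    exact hf s y hs
  · refine Nat.cast_le.2 (le_trans ?_ (Nat.mul_le_mul_left _ hl))
    clear hl
    induction l with
    | nil => simp
    | cons s l ih =>
      have : (f s).length ≤ ∑ s, (f s).length :=
        Finset.single_le_sum (f := fun s => (f s).length) (fun _ _ => Nat.zero_le _)
          (Finset.mem_univ s)
      rw [List.flatMap_cons, List.length_append, List.length_cons, mul_add]
      omega
  · clear hl
    induction l with
    | nil => rfl
    | cons s l ih => rw [List.flatMap_cons, List.prod_append, ih, he, ← eval_cons]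

theorem exists_ball_subset_letterBall (ω : ℕ → Fin 3) (S : Finset (GrigorchukGroup ω)) :
    ∃ L : ℕ, 0 < L ∧ ∀ R : ℝ, 0 ≤ R → ball S R ⊆ letterBall ω (L * ⌊R⌋₊) := by
  choose f hf using eval_surjective ω
  refine ⟨S.sup (fun g => (f g).length) + 1, Nat.succ_pos _, fun R hR => ?_⟩
  rintro _ ⟨l, hl, hlen, rfl⟩
  rw [← Nat.le_floor_iff hR] at hlen
  have key : ∀ g, g ∈ S ∨ g⁻¹ ∈ S →
      ∃ m : List Letter, m.length ≤ S.sup (fun g => (f g).length) ∧ eval ω m = g := by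
    rintro g (hg | hg)
    · exact ⟨f g, Finset.le_sup (f := fun g => (f g).length) hg, hf g⟩
    · refine ⟨(f g⁻¹).reverse, ?_, ?_⟩
      · rw [List.length_reverse]
        exact Finset.le_sup (f := fun g => (f g).length) hg
      · rw [eval, word_reverse, QuotientGroup.mk_inv]
        exact inv_eq_iff_eq_inv.2 (hf g⁻¹)
  have main : ∃ m : List Letter,
      m.length ≤ (S.sup (fun g => (f g).length) + 1) * l.length ∧ eval ω m = l.prod := by
    clear hlen
    induction l with
    | nil => exact ⟨[], by simp, rfl⟩
    | cons g l ih =>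
      obtain ⟨m, hm, e⟩ := ih fun s hs => hl s (List.mem_cons_of_mem _ hs)
      obtain ⟨m', hm', e'⟩ := key g (hl g List.mem_cons_self)
      refine ⟨m' ++ m, ?_, by rw [eval_append, e, e', List.prod_cons]⟩
      rw [List.length_append, List.length_cons, mul_add]
      omega
  obtain ⟨m, hm, e⟩ := main
  exact ⟨m, hm.trans (Nat.mul_le_mul_left _ hlen), e⟩

theorem growth_lower_bound {ω : ℕ → Fin 3} (hω : ∀ k : Fin 3, {n : ℕ | ω n = k}.Infinite)
    {S : Finset (GrigorchukGroup ω)}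
    (hS : Subgroup.closure (S : Set (GrigorchukGroup ω)) = ⊤) (d : ℕ) :
    ∃ L > 0, ∃ C > 0, ∀ R : ℝ, 1 ≤ R → R ^ d ≤ C * growth S (L * R) := by
  obtain ⟨L, hL, h⟩ := exists_letterBall_subset_ball ω hS
  obtain ⟨L', -, h'⟩ := exists_ball_subset_letterBall ω S
  -- The exponent `2 ^ (2 * d)` exceeds `2 * d`, so `n ^ d` remains after a square root.
  obtain ⟨K, hK, hV⟩ := pow_le_sq_ncard_letterBall (2 * d) ω hω
  refine ⟨L, by positivity, 2 ^ d * K, by positivity, fun R hR => ?_⟩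
  set n := ⌊R⌋₊ with hn
  have hn1 : 1 ≤ n := Nat.le_floor (by simpa using hR)
  have hRn : R ≤ 2 * n := by
    have h1 := Nat.lt_floor_add_one R
    have h2 : (1 : ℝ) ≤ n := mod_cast hn1
    rw [← hn] at h1
    linarith
  have hLR : ((L * n : ℕ) : ℝ) ≤ L * R := by
    rw [Nat.cast_mul]
    exact mul_le_mul_of_nonneg_left (Nat.floor_le (by linarith)) (Nat.cast_nonneg _)
  -- Monotonicity of `ncard` requires the larger ball to be finite, hence the reverse inclusion
  -- `h'`.
  have hcard : (letterBall ω n).ncard ≤ (ball S (L * R)).ncard :=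
    Set.ncard_le_ncard ((h n).trans (ball_mono S hLR))
      ((finite_letterBall ω _).subset (h' _ (by positivity)))
  have hpow : n ^ d ≤ K * (letterBall ω n).ncard := by
    refine (Nat.pow_le_pow_iff_left two_ne_zero).1 ?_
    rw [← pow_mul, mul_comm d 2, mul_pow]
    calc n ^ (2 * d) ≤ n ^ 2 ^ (2 * d) := Nat.pow_le_pow_right hn1 Nat.lt_two_pow_self.le
      _ ≤ K * (letterBall ω n).ncard ^ 2 := hV n
      _ ≤ K ^ 2 * (letterBall ω n).ncard ^ 2 :=
        Nat.mul_le_mul_right _ (Nat.le_self_pow two_ne_zero K)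
  have hfin : (n : ℝ) ^ d ≤ K * growth S (L * R) := by
    rw [growth]
    exact_mod_cast hpow.trans (Nat.mul_le_mul_left K hcard)
  calc R ^ d ≤ (2 * n) ^ d := pow_le_pow_left₀ (by linarith) hRn d
    _ = 2 ^ d * (n : ℝ) ^ d := mul_pow _ _ _
    _ ≤ 2 ^ d * (K * growth S (L * R)) := mul_le_mul_of_nonneg_left hfin (by positivity)
    _ = _ := by ring

theorem growth_upper_bound {ω : ℕ → Fin 3} (hω : ∀ k : Fin 3, {n : ℕ | ω n = k}.Infinite)
    (S : Finset (GrigorchukGroup ω)) {s : ℝ} (hs : 0 < s) :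
    ∃ K > 0, ∀ R : ℝ, 0 ≤ R → growth S R ≤ K * Real.exp (s * R) := by
  obtain ⟨L, hL, h⟩ := exists_ball_subset_letterBall ω S
  have hL' : (0 : ℝ) < L := Nat.cast_pos.2 hL
  obtain ⟨K, hK, hV⟩ := ncard_letterBall_le hω (div_pos hs hL')
  refine ⟨K, hK, fun R hR => ?_⟩
  have hcard : growth S R ≤ (letterBall ω (L * ⌊R⌋₊)).ncard :=
    Nat.cast_le.2 (Set.ncard_le_ncard (h R hR) (finite_letterBall ω _))
  refine (hcard.trans (hV _)).trans (mul_le_mul_of_nonneg_left (Real.exp_le_exp.2 ?_) hK.le)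
  rw [Nat.cast_mul, ← mul_assoc, div_mul_cancel₀ _ hL'.ne']
  exact mul_le_mul_of_nonneg_left (Nat.floor_le hR) hs.le

end Grigorchuk

theorem mainTheorem9 (ω : ℕ → Fin 3) (hω : ∀ k : Fin 3, {n : ℕ | ω n = k}.Infinite) :
    WordGrowth.HasIntermediateGrowth (Grigorchuk.GrigorchukGroup ω) := by
  refine ⟨?_, fun S hS => WordGrowth.isIntermediate_of_bounds
    (Grigorchuk.growth_lower_bound hω hS) (fun s hs => Grigorchuk.growth_upper_bound hω S hs)⟩
  have hF : Function.Surjective ((QuotientGroup.mk' (Grigorchuk.kernel ω)).comp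
      (PresentedGroup.mk Grigorchuk.relators)) :=
    (QuotientGroup.mk'_surjective _).comp (PresentedGroup.mk_surjective _)
  exact Group.fg_of_surjective hF
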